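/- **Theorem 4.1.** For $n\ge 1$ and $A\in\mathbb C^{n\times n}$ let $W(A)=\{\langle Ax,x\rangle : x\in\mathbb C^n,\ \|x\|=1\}$ be the numerical range of $A$. Call a subset of $\mathbb C$ *bi-elliptical* if it is the convex hull of two non-degenerate ellipses (circles allowed) with distinct centers, neither of which lies in the closed elliptical disk bounded by the other. Let $u\in\mathbb R$, $b_1,b_2\in\mathbb C$ and $b\ge 0$, put $\xi_j=\operatorname{Re} b_j$, $\eta_j=\operatorname{Im} b_j$ ($j=1,2$), $B=\begin{bmatrix} b_1 & b\\ 0& b_2\end{bmatrix}$, and let $$A=\begin{bmatrix} uI & B^*+I\\ B-I & -uI\end{bmatrix}=\begin{bmatrix} u & 0 & \overline{b_1}+1 & 0\\ 0 & u & b & \overline{b_2}+1\\ b_1-1 & b & -u & 0\\ 0 & b_2-1 & 0 & -u\end{bmatrix}.$$ Then $W(A)$ is bi-elliptical if and only if $b\neq 0$ and at least one of the following holds: (i) $\eta_1=\eta_2$ and $4b^2u^2=(\xi_1^2-\xi_2^2)^2$; (ii) $u=\xi_1=\xi_2=0$. -/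

import Mathlib

/-- The numerical range `W(A) = {⟨Ax, x⟩ : x ∈ ℂⁿ, ‖x‖ = 1}` of a complex square matrix.
Mathlib's inner product is linear in its second argument, so `⟨Ax, x⟩` is `inner ℂ x (A x)`. -/
def numericalRange {n : ℕ} (A : Matrix (Fin n) (Fin n) ℂ) : Set ℂ :=
  {z | ∃ x : EuclideanSpace ℂ (Fin n), ‖x‖ = 1 ∧ inner ℂ x (Matrix.toEuclideanLin A x) = z}

/-- A non-degenerate ellipse in the complex plane, given by its center, the angle between the real
axis and its first axis, and its two (positive) semi-axes, in no particular order. Circles are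
included. -/
structure Ellipse where
  center : ℂ
  angle : ℝ
  semiAxis₁ : ℝ
  semiAxis₂ : ℝ
  semiAxis₁_pos : 0 < semiAxis₁
  semiAxis₂_pos : 0 < semiAxis₂

/-- The ellipse as a curve: the points `c + e^{iφ} (a₁ cos t + i a₂ sin t)`, `t` real. -/
def Ellipse.curve (E : Ellipse) : Set ℂ :=
  Set.range fun t : ℝ =>
    E.center + Complex.exp (E.angle * Complex.I) *
      ((E.semiAxis₁ * Real.cos t : ℝ) + (E.semiAxis₂ * Real.sin t : ℝ) * Complex.I)

/-- The closed elliptical disk bounded by the ellipse. -/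
def Ellipse.disk (E : Ellipse) : Set ℂ :=
  convexHull ℝ E.curve

/-- A set has bi-elliptical shape if it is the convex hull of two non-degenerate ellipses with
distinct centers, neither of which lies in the elliptical disk bounded by the other one
(otherwise the convex hull would be just an elliptical disk). -/
def IsBiElliptical (S : Set ℂ) : Prop :=
  ∃ E₁ E₂ : Ellipse, E₁.center ≠ E₂.center ∧
    ¬ E₁.curve ⊆ E₂.disk ∧ ¬ E₂.curve ⊆ E₁.disk ∧
    S = convexHull ℝ (E₁.curve ∪ E₂.curve)

/-- The matrix `[[α I, B* + I], [B - I, -α I]]` with `B = [[b₁, b], [0, b₂]]`, `b` real. -/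
def triangularizedMatrix (α b₁ b₂ : ℂ) (b : ℝ) : Matrix (Fin 4) (Fin 4) ℂ :=
  !![α, 0, star b₁ + 1, 0;
     0, α, (b : ℂ), star b₂ + 1;
     b₁ - 1, (b : ℂ), -α, 0;
     0, b₂ - 1, 0, -α]

/-! Compact convex sets are compared through support functions. For `W(A)`, the support function in
direction `w = c + is` is the largest eigenvalue of `H = Re(w̄A)`. Here `H = [[cu, X*], [X, -cu]]`
with `X = cB + isI`, so its eigenvalues are `±√(c²u² + σ²)`, `σ` a singular value of `X`;
`det_sub_directionalPart` gives the resulting biquadratic.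

An ellipse has support function `l + √f`, with `l` linear and `f` a positive definite quadratic
form. If `W(A)` is bi-elliptical, one ellipse has a nonzero center and dominates on an open set of
directions, where `l + √f` is therefore an eigenvalue. As `√f` is not rational
(`eq_zero_of_infinite_sq_eq_sq_mul`), the rational and irrational parts vanish separately, giving
two polynomial identities; `parameter_conditions` reads the conditions off their coefficients.

Conversely, the conditions make the eigenvalues `±kc ± √f`. The largest, `|kc| + √f`, is the support
function of the hull of two translates of one ellipse, centered at `±k`; convexity of `W(A)`
finishes. -/

/-! ### Convex hulls and support functions in the plane. -/

/-- By Carathéodory, at most `dim E + 1` points suffice, so the hull is a finite union of continuous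
images of compact sets. -/
theorem isCompact_convexHull_of_finiteDimensional {E : Type*} [NormedAddCommGroup E]
    [NormedSpace ℝ E] [FiniteDimensional ℝ E] {s : Set E} (hs : IsCompact s) :
    IsCompact (convexHull ℝ s) := by
  have h : convexHull ℝ s = ⋃ n ∈ Set.Iic (Module.finrank ℝ E + 1),
      (fun p : (Fin n → ℝ) × (Fin n → E) => ∑ i, p.1 i • p.2 i) ''
        (stdSimplex ℝ (Fin n) ×ˢ Set.univ.pi fun _ => s) := by
    ext x
    simp only [Set.mem_iUnion, Set.mem_Iic, Set.mem_image, Set.mem_prod, Set.mem_univ_pi,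
      Prod.exists, exists_prop]
    constructor
    · intro hx
      obtain ⟨ι, _, z, w, hz, hind, hw, hw1, hwz⟩ := eq_pos_convex_span_of_mem_convexHull hx
      have e := Fintype.equivFin ι
      refine ⟨Fintype.card ι, hind.card_le_finrank_succ.trans ?_, w ∘ e.symm, z ∘ e.symm,
        ⟨⟨fun i => (hw _).le, ?_⟩, fun i => hz ⟨_, rfl⟩⟩, ?_⟩
      · gcongr; exact Submodule.finrank_le _
      · rw [← hw1]; exact e.symm.sum_comp w
      · rw [← hwz]; exact e.symm.sum_comp fun i => w i • z i
    · rintro ⟨n, -, w, z, ⟨hw, hz⟩, rfl⟩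
      exact (convex_convexHull ℝ s).sum_mem (fun i _ => hw.1 i) hw.2
        fun i _ => subset_convexHull ℝ s (hz i)
  rw [h]
  refine (Set.finite_Iic _).isCompact_biUnion fun n _ => ?_
  exact ((isCompact_stdSimplex ℝ (Fin n)).prod (isCompact_univ_pi fun _ => hs)).image (by fun_prop)

/-- The Euclidean inner product of the real plane `ℂ`. -/
def planeDot (w z : ℂ) : ℝ := w.re * z.re + w.im * z.im

theorem planeDot_add (w z z' : ℂ) : planeDot w (z + z') = planeDot w z + planeDot w z' := by
  simp only [planeDot, Complex.add_re, Complex.add_im]; ring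

theorem planeDot_le_of_mem_convexHull {s : Set ℂ} {w z : ℂ} {M : ℝ}
    (h : ∀ y ∈ s, planeDot w y ≤ M) (hz : z ∈ convexHull ℝ s) : planeDot w z ≤ M := by
  have hc : Convex ℝ {y | planeDot w y ≤ M} := by
    refine convex_halfSpace_le (f := planeDot w) ⟨planeDot_add w, fun c z => ?_⟩ M
    simp only [planeDot, Complex.smul_re, Complex.smul_im, smul_eq_mul]; ring
  exact convexHull_min h hc hz

theorem exists_planeDot_separation {K : Set ℂ} (hK : Convex ℝ K) (hcl : IsClosed K) {z : ℂ}
    (hz : z ∉ K) : ∃ (w : ℂ) (r : ℝ), (∀ y ∈ K, planeDot w y < r) ∧ r < planeDot w z := by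
  obtain ⟨f, r, h1, h2⟩ := geometric_hahn_banach_closed_point hK hcl hz
  have hf : ∀ y : ℂ, planeDot ⟨f 1, f Complex.I⟩ y = f y := by
    intro y
    conv_rhs => rw [← Complex.re_add_im y]
    have : ((y.re : ℂ) + y.im * Complex.I) = y.re • (1 : ℂ) + y.im • Complex.I := by simp
    rw [this, map_add, map_smul, map_smul]
    simp only [planeDot, smul_eq_mul]; ring
  exact ⟨⟨f 1, f Complex.I⟩, r, fun y hy => (hf y).trans_lt (h1 y hy), h2.trans_eq (hf z).symm⟩

/-- A closed convex set contained in every supporting half plane of another closed convex set lies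
in that set. -/
theorem subset_of_support_le {K L : Set ℂ} (hL : Convex ℝ L) (hcl : IsClosed L) {h : ℂ → ℝ}
    (hK : ∀ w, ∀ z ∈ K, planeDot w z ≤ h w) (hLh : ∀ w, ∃ z ∈ L, planeDot w z = h w) : K ⊆ L := by
  intro z hz
  by_contra hzL
  obtain ⟨w, r, h1, h2⟩ := exists_planeDot_separation hL hcl hzL
  obtain ⟨y, hy, hyw⟩ := hLh w
  linarith [hK w z hz, h1 y hy]

theorem exists_cos_sin_max (p q : ℝ) :
    (∀ t : ℝ, p * Real.cos t + q * Real.sin t ≤ √(p ^ 2 + q ^ 2)) ∧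
      ∃ t : ℝ, p * Real.cos t + q * Real.sin t = √(p ^ 2 + q ^ 2) := by
  constructor
  · intro t
    refine Real.le_sqrt_of_sq_le ?_
    nlinarith [sq_nonneg (p * Real.sin t - q * Real.cos t), Real.sin_sq_add_cos_sq t]
  · refine ⟨Complex.arg ⟨p, q⟩, ?_⟩
    have hn : ‖(⟨p, q⟩ : ℂ)‖ = √(p ^ 2 + q ^ 2) := by
      rw [Complex.norm_def, Complex.normSq_apply]; congr 1; ring
    have h1 := Complex.norm_mul_cos_arg ⟨p, q⟩
    have h2 := Complex.norm_mul_sin_arg ⟨p, q⟩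
    rw [hn] at h1 h2
    simp only at h1 h2
    have hs : √(p ^ 2 + q ^ 2) ^ 2 = p ^ 2 + q ^ 2 := Real.sq_sqrt (by positivity)
    have ht := Real.sin_sq_add_cos_sq (Complex.arg ⟨p, q⟩)
    generalize Complex.arg ⟨p, q⟩ = t at *
    generalize √(p ^ 2 + q ^ 2) = r at *
    rw [← h1, ← h2]
    linear_combination r * ht

/-! ### Ellipses as support functions. -/

namespace Ellipse

/-- The quadratic form whose square root is the support function of the ellipse translated to the
origin. -/
noncomputable def supportForm (E : Ellipse) (w : ℂ) : ℝ :=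
  (E.semiAxis₁ * (w.re * Real.cos E.angle + w.im * Real.sin E.angle)) ^ 2 +
    (E.semiAxis₂ * (w.im * Real.cos E.angle - w.re * Real.sin E.angle)) ^ 2

/-- The support function of an ellipse. -/
noncomputable def support (E : Ellipse) (w : ℂ) : ℝ := planeDot w E.center + √(E.supportForm w)

theorem continuous_support (E : Ellipse) : Continuous E.support := by
  unfold support supportForm planeDot
  fun_prop

theorem planeDot_curve (E : Ellipse) (w : ℂ) (t : ℝ) :
    planeDot w (E.center + Complex.exp (E.angle * Complex.I) *
      ((E.semiAxis₁ * Real.cos t : ℝ) + (E.semiAxis₂ * Real.sin t : ℝ) * Complex.I)) =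
    planeDot w E.center +
      (E.semiAxis₁ * (w.re * Real.cos E.angle + w.im * Real.sin E.angle) * Real.cos t +
        E.semiAxis₂ * (w.im * Real.cos E.angle - w.re * Real.sin E.angle) * Real.sin t) := by
  rw [planeDot_add, planeDot, planeDot]
  simp only [Complex.mul_re, Complex.mul_im, Complex.add_re, Complex.add_im, Complex.I_re,
    Complex.I_im, Complex.ofReal_re, Complex.ofReal_im, Complex.exp_ofReal_mul_I_re,
    Complex.exp_ofReal_mul_I_im]
  ring

theorem planeDot_le_support (E : Ellipse) (w : ℂ) {z : ℂ} (hz : z ∈ E.curve) :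
    planeDot w z ≤ E.support w := by
  obtain ⟨t, rfl⟩ := hz
  rw [planeDot_curve, support]
  gcongr
  exact (exists_cos_sin_max _ _).1 t

theorem exists_planeDot_eq_support (E : Ellipse) (w : ℂ) :
    ∃ z ∈ E.curve, planeDot w z = E.support w := by
  obtain ⟨t, ht⟩ := (exists_cos_sin_max
    (E.semiAxis₁ * (w.re * Real.cos E.angle + w.im * Real.sin E.angle))
    (E.semiAxis₂ * (w.im * Real.cos E.angle - w.re * Real.sin E.angle))).2
  exact ⟨_, ⟨t, rfl⟩, by rw [planeDot_curve, support, ht]; rfl⟩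

theorem isCompact_curve (E : Ellipse) : IsCompact E.curve := by
  have h : E.curve = (fun t : ℝ => E.center + Complex.exp (E.angle * Complex.I) *
      ((E.semiAxis₁ * Real.cos t : ℝ) + (E.semiAxis₂ * Real.sin t : ℝ) * Complex.I)) ''
        Set.Icc 0 (2 * Real.pi) := by
    rw [curve]
    refine (Function.Periodic.image_Icc (c := 2 * Real.pi) ?_ Real.two_pi_pos 0 ▸ ?_)
    · intro t
      simp only [Real.cos_add_two_pi, Real.sin_add_two_pi]
    · rw [zero_add]
  rw [h]
  refine isCompact_Icc.image ?_
  fun_prop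

theorem isCompact_disk (E : Ellipse) : IsCompact E.disk := isCompact_convexHull_of_finiteDimensional E.isCompact_curve

theorem not_curve_subset_disk_iff (E F : Ellipse) :
    ¬ E.curve ⊆ F.disk ↔ ∃ w, F.support w < E.support w := by
  constructor
  · intro h
    obtain ⟨z, hz, hzF⟩ := Set.not_subset.1 h
    obtain ⟨w, r, h1, h2⟩ :=
      exists_planeDot_separation (convex_convexHull ℝ _) F.isCompact_disk.isClosed hzF
    obtain ⟨y, hy, hyw⟩ := F.exists_planeDot_eq_support w
    refine ⟨w, ?_⟩
    linarith [h1 y (subset_convexHull ℝ _ hy), E.planeDot_le_support w hz]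
  · rintro ⟨w, hw⟩ h
    obtain ⟨z, hz, hzw⟩ := E.exists_planeDot_eq_support w
    have := planeDot_le_of_mem_convexHull (fun y hy => F.planeDot_le_support w hy) (h hz)
    linarith

/-- The support form of an ellipse is a positive definite quadratic form. -/
theorem exists_supportForm_coeff (E : Ellipse) : ∃ p q r : ℝ, 0 < r ∧ q ^ 2 < p * r ∧
    ∀ w, E.supportForm w = p * w.re ^ 2 + 2 * q * w.re * w.im + r * w.im ^ 2 := by
  obtain ⟨_, φ, a, d, ha, hd⟩ := E
  have h := Real.sin_sq_add_cos_sq φ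
  refine ⟨a ^ 2 * Real.cos φ ^ 2 + d ^ 2 * Real.sin φ ^ 2, (a ^ 2 - d ^ 2) * Real.cos φ * Real.sin φ,
    a ^ 2 * Real.sin φ ^ 2 + d ^ 2 * Real.cos φ ^ 2, ?_, ?_, fun w => ?_⟩
  · rcases eq_or_ne (Real.sin φ) 0 with h0 | h0
    · have : Real.cos φ ≠ 0 := fun hc => by simp [h0, hc] at h
      positivity
    · positivity
  · have h2 : 0 < (a * d * (Real.sin φ ^ 2 + Real.cos φ ^ 2)) ^ 2 := by rw [h]; positivity
    linarith
  · simp only [supportForm]; ring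

/-- Every positive definite quadratic form is the support form of an ellipse with any given center. -/
theorem exists_of_supportForm (k : ℂ) {p q r : ℝ} (hr : 0 < r) (hq : q ^ 2 < p * r) :
    ∃ E : Ellipse, E.center = k ∧
      ∀ w, E.supportForm w = p * w.re ^ 2 + 2 * q * w.re * w.im + r * w.im ^ 2 := by
  have hp : 0 < p := by
    by_contra! h
    nlinarith [sq_nonneg q]
  -- The form has eigenvalues `(p + r)/2 ± ‖z‖`, the squared semi-axes; its principal axis is at
  -- half the argument of `z`.
  set z : ℂ := ⟨(p - r) / 2, q⟩ with hz
  set φ := z.arg / 2 with hφ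
  have h1 : ‖z‖ * Real.cos (2 * φ) = (p - r) / 2 := by
    rw [hφ, mul_div_cancel₀ _ two_ne_zero, Complex.norm_mul_cos_arg]
  have h2 : ‖z‖ * Real.sin (2 * φ) = q := by
    rw [hφ, mul_div_cancel₀ _ two_ne_zero, Complex.norm_mul_sin_arg]
  have hn : ‖z‖ ^ 2 = ((p - r) / 2) ^ 2 + q ^ 2 := by
    rw [Complex.sq_norm, Complex.normSq_apply]; simp only [hz]; ring
  have hlt : ‖z‖ < (p + r) / 2 := by
    refine lt_of_pow_lt_pow_left₀ 2 (by positivity) ?_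
    rw [hn]; nlinarith
  have h0 := norm_nonneg z
  generalize ‖z‖ = m at *
  refine ⟨⟨k, φ, √((p + r) / 2 + m), √((p + r) / 2 - m), Real.sqrt_pos.2 (by positivity),
    Real.sqrt_pos.2 (by linarith)⟩, rfl, fun w => ?_⟩
  simp only [supportForm, mul_pow]
  rw [Real.sq_sqrt (by positivity), Real.sq_sqrt (by linarith)]
  rw [Real.cos_two_mul] at h1
  rw [Real.sin_two_mul] at h2
  have h := Real.sin_sq_add_cos_sq φ
  have hs : Real.sin φ ^ 2 = 1 - Real.cos φ ^ 2 := by linarith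
  rw [← h2]
  have e : ((p + r) / 2 + m) * (w.re * Real.cos φ + w.im * Real.sin φ) ^ 2 +
      ((p + r) / 2 - m) * (w.im * Real.cos φ - w.re * Real.sin φ) ^ 2 =
      (p + r) / 2 * (w.re ^ 2 + w.im ^ 2) * (Real.sin φ ^ 2 + Real.cos φ ^ 2) +
      m * (w.re ^ 2 - w.im ^ 2) * (Real.cos φ ^ 2 - Real.sin φ ^ 2) +
      2 * (m * (2 * Real.sin φ * Real.cos φ)) * w.re * w.im := by ring
  rw [e, hs]
  linear_combination (w.re ^ 2 - w.im ^ 2) * h1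

end Ellipse

/-! ### Convexity and compactness of the numerical range. -/

open scoped ComplexConjugate in
/-- **Toeplitz–Hausdorff theorem.** -/
theorem convex_quadraticValues {E : Type*} [NormedAddCommGroup E] [InnerProductSpace ℂ E]
    (T : E →ₗ[ℂ] E) : Convex ℝ {z : ℂ | ∃ x : E, ‖x‖ = 1 ∧ inner ℂ x (T x) = z} := by
  rw [convex_iff_segment_subset]
  rintro _ ⟨x, hx, rfl⟩ _ ⟨y, hy, rfl⟩
  set a : ℂ := inner ℂ x (T x) with ha
  set d : ℂ := inner ℂ y (T y) - a with hd
  rcases eq_or_ne d 0 with h0 | h0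
  · rw [sub_eq_zero.1 h0, segment_same, Set.singleton_subset_iff]
    exact ⟨x, hx, rfl⟩
  -- `S` is normalised so that its form is `0` at `x` and `1` at `y`.
  set S : E →ₗ[ℂ] E := d⁻¹ • (T - a • LinearMap.id) with hS
  have hform : ∀ v : E, inner ℂ v (T v) = a * ‖v‖ ^ 2 + d * inner ℂ v (S v) := by
    intro v
    simp only [hS, LinearMap.smul_apply, LinearMap.sub_apply, LinearMap.id_apply, inner_smul_right,
      inner_sub_right, inner_self_eq_norm_sq_to_K, Complex.coe_algebraMap]
    field_simp
    ring
  have hSx : inner ℂ x (S x) = 0 := by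
    have := hform x
    rw [hx, ← ha] at this
    simpa [h0] using this
  have hSy : inner ℂ y (S y) = 1 := by
    have := hform y
    rw [hy] at this
    have h2 : d * inner ℂ y (S y) = d * 1 := by rw [mul_one, hd]; push_cast at this; linear_combination -this
    exact mul_left_cancel₀ h0 h2
  -- Rotating `x` by a phase makes the mixed term real. The form is then real along the line from `c
  -- • x` to `y`, and the intermediate value theorem applies.
  obtain ⟨c, hc, hcim⟩ : ∃ c : ℂ, ‖c‖ = 1 ∧
      (conj c * inner ℂ x (S y) + c * inner ℂ y (S x)).im = 0 := by
    set m := inner ℂ x (S y) - conj (inner ℂ y (S x)) with hm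
    rcases eq_or_ne m 0 with h | h
    · refine ⟨1, norm_one, ?_⟩
      have := congrArg Complex.im h
      rw [hm, Complex.sub_im, Complex.conj_im, Complex.zero_im] at this
      simp only [map_one, one_mul, Complex.add_im]; linarith
    · refine ⟨m / ‖m‖, by simp [h], ?_⟩
      have h1 : (conj (m / ‖m‖) * m).im = 0 := by
        rw [map_div₀, Complex.conj_ofReal, div_mul_eq_mul_div, mul_comm, Complex.mul_conj,
          ← Complex.ofReal_div, Complex.ofReal_im]
      rw [hm, mul_sub, ← map_mul, ← hm, Complex.sub_im, Complex.conj_im] at h1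
      rw [Complex.add_im]; linarith
  set x' := c • x with hx'
  have hx'n : ‖x'‖ = 1 := by rw [hx', norm_smul, hc, hx, one_mul]
  have hSx' : inner ℂ x' (S x') = 0 := by
    rw [hx', map_smul, inner_smul_left, inner_smul_right, hSx, mul_zero, mul_zero]
  obtain ⟨g, hg⟩ : ∃ g : ℝ, inner ℂ x' (S y) + inner ℂ y (S x') = g := by
    refine ⟨(inner ℂ x' (S y) + inner ℂ y (S x')).re, ?_⟩
    refine Complex.ext rfl ?_
    rw [hx', map_smul, inner_smul_left, inner_smul_right, hcim, Complex.ofReal_im]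
  set v : ℝ → E := fun t => ((1 - t : ℝ) : ℂ) • x' + (t : ℂ) • y with hv
  have hSv : ∀ t, inner ℂ (v t) (S (v t)) = ((t ^ 2 + t * (1 - t) * g : ℝ) : ℂ) := by
    intro t
    simp only [hv, map_add, map_smul, inner_add_left, inner_add_right, inner_smul_left,
      inner_smul_right, hSx', hSy, Complex.conj_ofReal]
    push_cast
    linear_combination (t * (1 - t) : ℂ) * hg
  -- If `v t = 0`, then `(1 - t) • x' = -t • y`, and evaluating the form on both sides gives `0 =
  -- t²`.
  have hv0 : ∀ t, v t ≠ 0 := by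
    intro t ht
    have hlin : ((1 - t : ℝ) : ℂ) • x' = -((t : ℂ) • y) := eq_neg_of_add_eq_zero_left ht
    have h1 : inner ℂ (((1 - t : ℝ) : ℂ) • x') (S (((1 - t : ℝ) : ℂ) • x')) = 0 := by
      rw [map_smul, inner_smul_left, inner_smul_right, hSx', mul_zero, mul_zero]
    rw [hlin, map_neg, map_smul, inner_neg_left, inner_neg_right, inner_smul_left,
      inner_smul_right, hSy] at h1
    have ht0 : t = 0 := by simpa using h1
    rw [ht0] at hlin
    simp at hlin
    rw [hlin, norm_zero] at hx'n
    exact zero_ne_one hx'n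
  set f : ℝ → ℝ := fun t => (t ^ 2 + t * (1 - t) * g) / ‖v t‖ ^ 2 with hf
  have hfc : Continuous f := by
    refine Continuous.div (by fun_prop) (by fun_prop) fun t => ?_
    exact pow_ne_zero 2 (norm_ne_zero_iff.2 (hv0 t))
  have hf0 : f 0 = 0 := by simp [hf]
  have hf1 : f 1 = 1 := by simp [hf, hv, hy]
  rw [segment_eq_image_lineMap]
  rintro _ ⟨s, hs, rfl⟩
  obtain ⟨t, -, ht⟩ := intermediate_value_Icc zero_le_one hfc.continuousOn
    (show s ∈ Set.Icc (f 0) (f 1) by rwa [hf0, hf1])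
  have hn : (‖v t‖ : ℂ) ≠ 0 := Complex.ofReal_ne_zero.2 (norm_ne_zero_iff.2 (hv0 t))
  refine ⟨((‖v t‖⁻¹ : ℝ) : ℂ) • v t, ?_, ?_⟩
  · rw [norm_smul, Complex.norm_real, norm_inv, norm_norm,
      inv_mul_cancel₀ (norm_ne_zero_iff.2 (hv0 t))]
  · rw [map_smul, inner_smul_left, inner_smul_right, hform, hSv, Complex.conj_ofReal, ← ht,
      AffineMap.lineMap_apply_module', hf, ← hd, Complex.real_smul]
    push_cast
    field_simp
    ring

theorem convex_numericalRange {n : ℕ} (A : Matrix (Fin n) (Fin n) ℂ) :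
    Convex ℝ (numericalRange A) := convex_quadraticValues _

theorem isCompact_numericalRange {n : ℕ} (A : Matrix (Fin n) (Fin n) ℂ) :
    IsCompact (numericalRange A) := by
  have h : numericalRange A = (fun x : EuclideanSpace ℂ (Fin n) =>
      inner ℂ x (Matrix.toEuclideanLin A x)) '' Metric.sphere 0 1 := by
    ext z; simp [numericalRange]
  rw [h]
  refine (isCompact_sphere _ _).image ?_
  have := LinearMap.continuous_of_finiteDimensional (Matrix.toEuclideanLin A)
  fun_prop

theorem numericalRange_nonempty {n : ℕ} [NeZero n] (A : Matrix (Fin n) (Fin n) ℂ) :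
    (numericalRange A).Nonempty :=
  ⟨_, EuclideanSpace.single 0 1, by simp, rfl⟩

/-! ### Supporting lines of the numerical range as eigenvalues. -/

section

open Matrix
open scoped ComplexOrder

/-- The Hermitian matrix `(w̄ A + w A*) / 2`, which is the real part of `w̄ A`. -/
noncomputable def directionalPart {n : ℕ} (A : Matrix (Fin n) (Fin n) ℂ) (w : ℂ) :
    Matrix (Fin n) (Fin n) ℂ := (2⁻¹ : ℂ) • (star w • A + w • Aᴴ)

theorem isHermitian_directionalPart {n : ℕ} (A : Matrix (Fin n) (Fin n) ℂ) (w : ℂ) :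
    (directionalPart A w).IsHermitian := by
  rw [Matrix.IsHermitian, directionalPart, conjTranspose_smul, conjTranspose_add,
    conjTranspose_smul, conjTranspose_smul, conjTranspose_conjTranspose, star_star, add_comm]
  simp

theorem dotProduct_directionalPart {n : ℕ} (A : Matrix (Fin n) (Fin n) ℂ) (w : ℂ)
    (x : EuclideanSpace ℂ (Fin n)) :
    star x.ofLp ⬝ᵥ directionalPart A w *ᵥ x.ofLp =
      (planeDot w (inner ℂ x (Matrix.toEuclideanLin A x)) : ℂ) := by
  have h1 : inner ℂ x (Matrix.toEuclideanLin A x) = star x.ofLp ⬝ᵥ A *ᵥ x.ofLp := by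
    rw [EuclideanSpace.inner_eq_star_dotProduct, dotProduct_comm]; rfl
  have h2 : star x.ofLp ⬝ᵥ Aᴴ *ᵥ x.ofLp = star (star x.ofLp ⬝ᵥ A *ᵥ x.ofLp) := by
    rw [← star_dotProduct, star_mulVec, dotProduct_mulVec]
  rw [h1, directionalPart, smul_mulVec, dotProduct_smul, add_mulVec, dotProduct_add, smul_mulVec,
    smul_mulVec, dotProduct_smul, dotProduct_smul, h2]
  generalize star x.ofLp ⬝ᵥ A *ᵥ x.ofLp = z
  apply Complex.ext <;> simp [planeDot] <;> ring

/-- Maximality makes `M - H` positive semidefinite, so a unit vector attaining `M` lies in its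
kernel. -/
theorem det_directionalPart_eq_zero {n : ℕ} {A : Matrix (Fin n) (Fin n) ℂ} {w : ℂ} {M : ℝ}
    (hle : ∀ z ∈ numericalRange A, planeDot w z ≤ M)
    (hM : ∃ z ∈ numericalRange A, planeDot w z = M) :
    ((M : ℂ) • 1 - directionalPart A w).det = 0 := by
  obtain ⟨_, ⟨x, hx, rfl⟩, hxM⟩ := hM
  have hval : ∀ y : EuclideanSpace ℂ (Fin n),
      star y.ofLp ⬝ᵥ ((M : ℂ) • 1 - directionalPart A w) *ᵥ y.ofLp =
        ((M * ‖y‖ ^ 2 - planeDot w (inner ℂ y (Matrix.toEuclideanLin A y)) : ℝ) : ℂ) := by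
    intro y
    rw [sub_mulVec, dotProduct_sub, dotProduct_directionalPart, smul_mulVec, one_mulVec,
      dotProduct_smul, dotProduct_comm, ← EuclideanSpace.inner_eq_star_dotProduct,
      inner_self_eq_norm_sq_to_K]
    push_cast
    simp
  have hpsd : ((M : ℂ) • 1 - directionalPart A w).PosSemidef := by
    rw [posSemidef_iff_dotProduct_mulVec]
    refine ⟨?_, fun v => ?_⟩
    · refine IsHermitian.sub ?_ (isHermitian_directionalPart A w)
      rw [IsHermitian, conjTranspose_smul, conjTranspose_one]; simp
    · have hv := hval (WithLp.toLp 2 v)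
      simp only at hv
      rw [hv, Complex.zero_le_real]
      rcases eq_or_ne (WithLp.toLp 2 v) 0 with h0 | h0
      · rw [h0]; simp [planeDot]
      have hn : 0 < ‖WithLp.toLp 2 v‖ := norm_pos_iff.2 h0
      have := hle _ ⟨((‖WithLp.toLp 2 v‖⁻¹ : ℝ) : ℂ) • WithLp.toLp 2 v, by
        rw [norm_smul, Complex.norm_real, norm_inv, norm_norm, inv_mul_cancel₀ hn.ne'], rfl⟩
      rw [map_smul, inner_smul_left, inner_smul_right, Complex.conj_ofReal, planeDot] at this
      simp only [Complex.re_ofReal_mul, Complex.im_ofReal_mul] at this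
      rw [planeDot]
      generalize inner ℂ (WithLp.toLp 2 v) (Matrix.toEuclideanLin A (WithLp.toLp 2 v)) = z at *
      field_simp at this
      linarith
  rw [← exists_mulVec_eq_zero_iff]
  refine ⟨x.ofLp, ?_, ?_⟩
  · intro h
    have : x = 0 := by ext i; exact congrFun h i
    rw [this, norm_zero] at hx
    exact zero_ne_one hx
  · rw [← hpsd.dotProduct_mulVec_zero_iff, hval, hx, hxM]; simp

theorem exists_planeDot_eq_of_det {n : ℕ} {A : Matrix (Fin n) (Fin n) ℂ} {w : ℂ} {M : ℝ}
    (h : ((M : ℂ) • 1 - directionalPart A w).det = 0) :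
    ∃ z ∈ numericalRange A, planeDot w z = M := by
  obtain ⟨v, hv0, hv⟩ := exists_mulVec_eq_zero_iff.2 h
  have hx0 : WithLp.toLp 2 v ≠ 0 := fun h => hv0 (by simpa using congrArg WithLp.ofLp h)
  set x : EuclideanSpace ℂ (Fin n) := ((‖WithLp.toLp 2 v‖⁻¹ : ℝ) : ℂ) • WithLp.toLp 2 v with hx
  have hxn : ‖x‖ = 1 := by
    rw [hx, norm_smul, Complex.norm_real, norm_inv, norm_norm,
      inv_mul_cancel₀ (norm_ne_zero_iff.2 hx0)]
  refine ⟨_, ⟨x, hxn, rfl⟩, ?_⟩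
  have h1 : directionalPart A w *ᵥ x.ofLp = (M : ℂ) • x.ofLp := by
    rw [sub_mulVec, smul_mulVec, one_mulVec, sub_eq_zero] at hv
    rw [hx, WithLp.ofLp_smul, mulVec_smul, ← hv, smul_comm]
  have h2 := dotProduct_directionalPart A w x
  rw [h1, dotProduct_smul, dotProduct_comm, ← EuclideanSpace.inner_eq_star_dotProduct,
    inner_self_eq_norm_sq_to_K, hxn] at h2
  exact_mod_cast (by simpa using h2.symm)

end

/-! ### The characteristic polynomial of the given matrix. -/

/-- The sum of the squared singular values of `c B + i s I` for `B = [[b₁, b], [0, b₂]]`. -/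
def pencilTrace (b₁ b₂ : ℂ) (b c s : ℝ) : ℝ :=
  (c * b₁.re) ^ 2 + (c * b₁.im + s) ^ 2 + ((c * b₂.re) ^ 2 + (c * b₂.im + s) ^ 2) + (c * b) ^ 2

/-- A quadratic form such that `c²` times it is the discriminant of the characteristic polynomial
of the matrix `X* X`, where `X = c B + i s I` and `B = [[b₁, b], [0, b₂]]`. -/
def pencilDisc (b₁ b₂ : ℂ) (b c s : ℝ) : ℝ :=
  (c * (b₁.re ^ 2 - b₂.re ^ 2 + b₁.im ^ 2 - b₂.im ^ 2) + 2 * s * (b₁.im - b₂.im)) ^ 2 +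
    2 * b ^ 2 * ((c * b₁.re) ^ 2 + (c * b₁.im + s) ^ 2 + ((c * b₂.re) ^ 2 + (c * b₂.im + s) ^ 2)) +
    c ^ 2 * b ^ 4

theorem det_sub_directionalPart (u : ℝ) (b₁ b₂ : ℂ) (b : ℝ) (w : ℂ) (r : ℝ) :
    ((r : ℂ) • 1 - directionalPart (triangularizedMatrix (u : ℂ) b₁ b₂ b) w).det =
      (((r ^ 2 - (w.re ^ 2 * u ^ 2 + pencilTrace b₁ b₂ b w.re w.im / 2)) ^ 2 -
        w.re ^ 2 * pencilDisc b₁ b₂ b w.re w.im / 4 : ℝ) : ℂ) := by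
  have hM : (r : ℂ) • 1 - directionalPart (triangularizedMatrix (u : ℂ) b₁ b₂ b) w =
      !![(r - w.re * u : ℂ), 0, -(w.re * (b₁.re - b₁.im * Complex.I) - w.im * Complex.I), 0;
        0, (r - w.re * u : ℂ), -(w.re * b : ℂ),
          -(w.re * (b₂.re - b₂.im * Complex.I) - w.im * Complex.I);
        -(w.re * (b₁.re + b₁.im * Complex.I) + w.im * Complex.I), -(w.re * b : ℂ),
          (r + w.re * u : ℂ), 0;
        0, -(w.re * (b₂.re + b₂.im * Complex.I) + w.im * Complex.I), 0, (r + w.re * u : ℂ)] := by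
    ext i j
    fin_cases i <;> fin_cases j <;>
      apply Complex.ext <;> simp [directionalPart, triangularizedMatrix] <;> ring
  rw [hM, Matrix.det_succ_row_zero]
  simp [-Complex.re_add_im, Fin.sum_univ_succ, Matrix.det_fin_three, Fin.succAbove, pencilTrace, pencilDisc]
  have hI : Complex.I ^ 2 = -1 := Complex.I_sq
  have hI4 : Complex.I ^ 4 = 1 := Complex.I_pow_four
  ring_nf
  simp only [hI, hI4]
  ring

/-! ### Necessity of the conditions. -/

open Polynomial in
/-- If `F² = G² q` at infinitely many points, where `q = p₀ + 2 p₁ t + p₂ t²` is a positive definite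
quadratic polynomial, then `F = G = 0`. -/
theorem eq_zero_of_infinite_sq_eq_sq_mul {F G : ℝ[X]} {p₀ p₁ p₂ : ℝ} (h2 : 0 < p₂)
    (hd : p₁ ^ 2 < p₀ * p₂) {S : Set ℝ} (hS : S.Infinite)
    (h : ∀ t ∈ S, F.eval t ^ 2 = G.eval t ^ 2 * (p₀ + 2 * p₁ * t + p₂ * t ^ 2)) :
    F = 0 ∧ G = 0 := by
  set q : ℝ[X] := C p₀ + C (2 * p₁) * X + C p₂ * X ^ 2 with hq
  have heq : F ^ 2 = G ^ 2 * q := by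
    refine eq_of_infinite_eval_eq _ _ (hS.mono fun t ht => ?_)
    simpa [hq] using h t ht
  -- The discriminant is negative, so `q` has two distinct complex roots. At one of them `F²` has
  -- even multiplicity, but `G² q` odd.
  have hG : G = 0 := by
    by_contra hG
    set m := √(p₀ * p₂ - p₁ ^ 2) with hm
    have hm2 : m ^ 2 = p₀ * p₂ - p₁ ^ 2 := Real.sq_sqrt (by linarith)
    have hm0 : 0 < m := Real.sqrt_pos.2 (by linarith)
    set z : ℂ := (-p₁ + m * Complex.I) / p₂ with hz
    set z' : ℂ := (-p₁ - m * Complex.I) / p₂ with hz'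
    have hp2 : (p₂ : ℂ) ≠ 0 := Complex.ofReal_ne_zero.2 h2.ne'
    have hne : z' ≠ z := by
      intro hc
      rw [hz, hz', div_left_inj' hp2] at hc
      have := congrArg Complex.im hc
      simp at this
      linarith
    have hqf : q.map (algebraMap ℝ ℂ) = C (p₂ : ℂ) * ((X - C z) * (X - C z')) := by
      have hs : (p₂ : ℂ) * (z + z') = -(2 * p₁) := by rw [hz, hz']; field_simp; ring
      have hpz : (p₂ : ℂ) * (z * z') = p₀ := by
        have : (m : ℂ) ^ 2 = p₀ * p₂ - p₁ ^ 2 := by exact_mod_cast hm2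
        rw [hz, hz']; field_simp
        linear_combination this - m ^ 2 * Complex.I_sq
      have e : C (p₂ : ℂ) * ((X - C z) * (X - C z')) =
          C (p₂ * (z * z')) + C (-(p₂ * (z + z'))) * X + C (p₂ : ℂ) * X ^ 2 := by
        simp only [map_mul, map_add, map_neg]; ring
      rw [e, hs, hpz, hq]
      simp
    have hF0 : F ^ 2 ≠ 0 := by
      rw [heq]
      refine mul_ne_zero (pow_ne_zero 2 hG) fun h0 => h2.ne' ?_
      have := congrArg (coeff · 2) h0
      simpa [hq, coeff_X, coeff_C] using this
    have hinj := map_injective (algebraMap ℝ ℂ) (algebraMap ℝ ℂ).injective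
    have hFc : F.map (algebraMap ℝ ℂ) ^ 2 ≠ 0 := by
      rw [← Polynomial.map_pow]; exact (Polynomial.map_ne_zero_iff (algebraMap ℝ ℂ).injective).2 hF0
    have hc := congrArg (fun P => (P.map (algebraMap ℝ ℂ)).rootMultiplicity z) heq
    simp only [Polynomial.map_mul, Polynomial.map_pow] at hc
    have hGc : G.map (algebraMap ℝ ℂ) ^ 2 * q.map (algebraMap ℝ ℂ) ≠ 0 := by
      rw [← Polynomial.map_pow, ← Polynomial.map_mul, ← heq, Polynomial.map_pow]; exact hFc
    have hqc := right_ne_zero_of_mul hGc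
    rw [rootMultiplicity_mul hGc, sq, sq, rootMultiplicity_mul (by rwa [sq] at hFc),
      rootMultiplicity_mul (by have := left_ne_zero_of_mul hGc; rwa [sq] at this)] at hc
    have h1 : (q.map (algebraMap ℝ ℂ)).rootMultiplicity z = 1 := by
      have hqc' := hqf ▸ hqc
      rw [hqf, rootMultiplicity_mul hqc', rootMultiplicity_mul (right_ne_zero_of_mul hqc'),
        rootMultiplicity_C, rootMultiplicity_X_sub_C_self,
        rootMultiplicity_eq_zero (by rw [IsRoot, eval_sub, eval_X, eval_C]; exact sub_ne_zero.2 hne.symm)]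
    omega
  refine ⟨?_, hG⟩
  rw [hG, zero_pow two_ne_zero, zero_mul] at heq
  exact pow_eq_zero_iff two_ne_zero |>.1 heq

/-- Comparison of coefficients: the characteristic polynomial contains the component of an ellipse
whose center `x + i y` is not the origin only if the parameters satisfy the stated conditions. -/
theorem parameter_conditions {u b x y p q r : ℝ} {b₁ b₂ : ℂ} (hr : 0 < r) (hq : q ^ 2 < p * r)
    (hxy : x ≠ 0 ∨ y ≠ 0)
    (h1 : ∀ t : ℝ, (x + y * t) ^ 2 + (p + 2 * q * t + r * t ^ 2) =
      u ^ 2 + pencilTrace b₁ b₂ b 1 t / 2)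
    (h2 : ∀ t : ℝ, 16 * (x + y * t) ^ 2 * (p + 2 * q * t + r * t ^ 2) =
      pencilDisc b₁ b₂ b 1 t) :
    b ≠ 0 ∧ ((b₁.im = b₂.im ∧ 4 * b ^ 2 * u ^ 2 = (b₁.re ^ 2 - b₂.re ^ 2) ^ 2) ∨
      (u = 0 ∧ b₁.re = 0 ∧ b₂.re = 0)) := by
  obtain ⟨ξ, η⟩ := b₁
  obtain ⟨ζ, θ⟩ := b₂
  simp only [pencilTrace, pencilDisc] at h1 h2 ⊢
  -- The right side of `h2` is quadratic in `t`; the fourth difference isolates the `t⁴` coefficient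
  -- `16 y² r`, times `4! = 24`.
  have hy : y = 0 := by
    have : y ^ 2 * r = 0 := by
      linear_combination (h2 2 - 4 * h2 1 + 6 * h2 0 - 4 * h2 (-1) + h2 (-2)) / 384
    simpa [hr.ne'] using this
  subst hy
  have hx : x ≠ 0 := by simpa using hxy
  have e0 := h1 0
  have e1 : 2 * q = η + θ := by linear_combination (h1 1 - h1 (-1)) / 2
  have e2 : r = 1 := by linear_combination (h1 1 + h1 (-1)) / 2 - h1 0
  have d0 := h2 0
  have d1 : 16 * x ^ 2 * (2 * q) = 4 * (ξ ^ 2 - ζ ^ 2 + η ^ 2 - θ ^ 2) * (η - θ) +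
      4 * b ^ 2 * (η + θ) := by linear_combination (h2 1 - h2 (-1)) / 2
  have d2 : 16 * x ^ 2 * r = 4 * ((η - θ) ^ 2 + b ^ 2) := by
    linear_combination (h2 1 + h2 (-1)) / 2 - h2 0
  subst e2
  -- For `b = 0` the right side of `h2` is a perfect square in `t`, with zero discriminant, while
  -- the left is `16 x²` times a positive definite form.
  have hb : b ≠ 0 := by
    rintro rfl
    have : (16 * x ^ 2) ^ 2 * (p - q ^ 2) = 0 := by
      linear_combination (16 * x ^ 2) * d0 + (ξ ^ 2 - ζ ^ 2 + η ^ 2 - θ ^ 2) ^ 2 * d2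
        - (16 * x ^ 2 * q / 2 + (ξ ^ 2 - ζ ^ 2 + η ^ 2 - θ ^ 2) * (η - θ)) * d1
    have hp : 0 < p - q ^ 2 := by linarith
    have : (16 * x ^ 2) ^ 2 * (p - q ^ 2) ≠ 0 := by positivity
    contradiction
  refine ⟨hb, ?_⟩
  have hprod : (η - θ) * (ξ ^ 2 - ζ ^ 2) = 0 := by
    linear_combination -d1 / 4 + 4 * x ^ 2 * e1 + (η + θ) / 4 * d2
  rcases mul_eq_zero.1 hprod with h | h
  · left
    refine ⟨sub_eq_zero.1 h, ?_⟩
    have hθ : θ = η := by linarith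
    subst hθ
    have hk : 4 * x ^ 2 = b ^ 2 := by linear_combination d2 / 4
    linear_combination -16 * x ^ 2 * e0 + d0 -
      (4 * u ^ 2 + 2 * (ξ ^ 2 + ζ ^ 2 + 2 * θ ^ 2 + b ^ 2) - 4 * x ^ 2 - b ^ 2) * hk
  · have hk : 4 * x ^ 2 = (η - θ) ^ 2 + b ^ 2 := by linear_combination d2 / 4
    have hz : ζ ^ 2 = ξ ^ 2 := by linarith
    have e0' : x ^ 2 + p = u ^ 2 + (2 * ξ ^ 2 + η ^ 2 + θ ^ 2 + b ^ 2) / 2 := by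
      linear_combination e0 + hz / 2
    have d0' : 16 * x ^ 2 * p = (η ^ 2 - θ ^ 2) ^ 2 +
        2 * b ^ 2 * (2 * ξ ^ 2 + η ^ 2 + θ ^ 2) + b ^ 4 := by
      linear_combination d0 + (ζ ^ 2 - ξ ^ 2 - 2 * (η ^ 2 - θ ^ 2) + 2 * b ^ 2) * hz
    -- Eliminating `p` leaves a sum of two nonnegative terms, so both vanish.
    have key : 4 * x ^ 2 * u ^ 2 + ξ ^ 2 * (η - θ) ^ 2 = 0 := by
      linear_combination (-16 * x ^ 2 * e0' + d0' + (4 * x ^ 2 + (η - θ) ^ 2 + b ^ 2 -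
        2 * (2 * ξ ^ 2 + η ^ 2 + θ ^ 2 + b ^ 2)) * hk) / 4
    have hn : 0 ≤ 4 * x ^ 2 * u ^ 2 := by positivity
    have hn' : 0 ≤ ξ ^ 2 * (η - θ) ^ 2 := by positivity
    have hu : u = 0 := by simpa [hx] using (show 4 * x ^ 2 * u ^ 2 = 0 by linarith)
    rcases mul_eq_zero.1 (show ξ ^ 2 * (η - θ) ^ 2 = 0 by linarith) with h0 | h0
    · exact Or.inr ⟨hu, by simpa using h0, by simpa [h0] using hz⟩
    · exact Or.inl ⟨sub_eq_zero.1 (by simpa using h0), by rw [hu, hz]; ring⟩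

theorem parameter_conditions_of_convexHull {u b : ℝ} {b₁ b₂ : ℂ} {E F : Ellipse}
    (hc : E.center ≠ 0) (hEF : ¬ E.curve ⊆ F.disk)
    (hW : numericalRange (triangularizedMatrix (u : ℂ) b₁ b₂ b) =
      convexHull ℝ (E.curve ∪ F.curve)) :
    b ≠ 0 ∧ ((b₁.im = b₂.im ∧ 4 * b ^ 2 * u ^ 2 = (b₁.re ^ 2 - b₂.re ^ 2) ^ 2) ∨
      (u = 0 ∧ b₁.re = 0 ∧ b₂.re = 0)) := by
  obtain ⟨p, q, r, hr, hq, hform⟩ := E.exists_supportForm_coeff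
  set x := E.center.re with hx
  set y := E.center.im with hy
  have hroot : ∀ w, F.support w < E.support w →
      ((E.support w ^ 2 - (w.re ^ 2 * u ^ 2 + pencilTrace b₁ b₂ b w.re w.im / 2)) ^ 2 -
        w.re ^ 2 * pencilDisc b₁ b₂ b w.re w.im / 4) = 0 := by
    intro w hw
    have := det_directionalPart_eq_zero (A := triangularizedMatrix (u : ℂ) b₁ b₂ b) (w := w)
      (M := E.support w) ?_ ?_
    · rw [det_sub_directionalPart] at this
      exact_mod_cast this
    · intro z hz
      rw [hW] at hz
      refine planeDot_le_of_mem_convexHull ?_ hz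
      rintro v (hv | hv)
      · exact E.planeDot_le_support w hv
      · exact (F.planeDot_le_support w hv).trans hw.le
    · obtain ⟨z, hz, hzw⟩ := E.exists_planeDot_eq_support w
      exact ⟨z, hW ▸ subset_convexHull ℝ _ (Or.inl hz), hzw⟩
  have hopen : IsOpen {w | F.support w < E.support w} :=
    isOpen_lt F.continuous_support E.continuous_support
  obtain ⟨w, hw⟩ := (E.not_curve_subset_disk_iff F).1 hEF
  have hmk : ∀ {f g : ℝ → ℝ}, Continuous f → Continuous g →
      Continuous fun t => (⟨f t, g t⟩ : ℂ) := fun hf hg => by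
    simp only [Complex.mk_eq_add_mul_I]
    fun_prop
  -- A nonzero first coordinate lets directions be written `(c, ct)`, reducing homogeneous forms to
  -- polynomials in `t`.
  obtain ⟨c, hcU, hc0⟩ : ∃ c : ℝ, F.support ⟨c, w.im⟩ < E.support ⟨c, w.im⟩ ∧ c ≠ 0 := by
    have hV : IsOpen {c : ℝ | F.support ⟨c, w.im⟩ < E.support ⟨c, w.im⟩} :=
      hopen.preimage (hmk continuous_id continuous_const)
    obtain ⟨c, h1, h2⟩ := ((infinite_of_mem_nhds w.re (hV.mem_nhds hw)).sdiff
      (Set.finite_singleton 0)).nonempty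
    exact ⟨c, h1, h2⟩
  have hS : Set.Infinite {t : ℝ | F.support ⟨c, c * t⟩ < E.support ⟨c, c * t⟩} := by
    refine infinite_of_mem_nhds (w.im / c) ((hopen.preimage
      (hmk continuous_const (continuous_const.mul continuous_id))).mem_nhds ?_)
    simpa [mul_div_cancel₀ _ hc0] using hcU
  open Polynomial in
  set l : ℝ[X] := C x + C y * X with hl
  open Polynomial in
  set f : ℝ[X] := C p + C (2 * q) * X + C r * X ^ 2 with hf
  open Polynomial in
  obtain ⟨T, hT⟩ : ∃ T : ℝ[X], ∀ t, T.eval t = u ^ 2 + pencilTrace b₁ b₂ b 1 t / 2 := by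
    refine ⟨C (u ^ 2) + C 2⁻¹ * ((C b₁.re) ^ 2 + (C b₁.im + X) ^ 2 +
      ((C b₂.re) ^ 2 + (C b₂.im + X) ^ 2) + C b ^ 2), fun t => ?_⟩
    simp [pencilTrace]; ring
  open Polynomial in
  obtain ⟨D, hD⟩ : ∃ D : ℝ[X], ∀ t, D.eval t = pencilDisc b₁ b₂ b 1 t := by
    refine ⟨(C (b₁.re ^ 2 - b₂.re ^ 2 + b₁.im ^ 2 - b₂.im ^ 2) + 2 * X * C (b₁.im - b₂.im)) ^ 2 +
      C (2 * b ^ 2) * ((C b₁.re) ^ 2 + (C b₁.im + X) ^ 2 +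
        ((C b₂.re) ^ 2 + (C b₂.im + X) ^ 2)) + C (b ^ 4), fun t => ?_⟩
    simp [pencilDisc]
  have hle : ∀ t, l.eval t = x + y * t := fun t => by simp [hl]
  have hfe : ∀ t, f.eval t = p + 2 * q * t + r * t ^ 2 := fun t => by simp [hf]
  -- Substituting the root `cl + g`, with `g² = c² f`, in the biquadratic gives `c⁴ F + c³ G g = 0`.
  -- Squaring removes `g`, whatever the sign of `c`.
  have hzero := eq_zero_of_infinite_sq_eq_sq_mul (F := (l ^ 2 + f - T) ^ 2 + 4 * l ^ 2 * f -
    Polynomial.C 4⁻¹ * D) (G := 4 * l * (l ^ 2 + f - T)) hr hq hS ?_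
  · obtain ⟨hF, hG⟩ := hzero
    have hl0 : l ≠ 0 := by
      intro h
      have h0 := hle 0
      have h1 := hle 1
      rw [h, Polynomial.eval_zero] at h0 h1
      exact hc (Complex.ext (by simp; linarith) (by simp; linarith))
    have hT0 : l ^ 2 + f - T = 0 := by
      simpa [hl0] using hG
    rw [hT0] at hF
    refine parameter_conditions (x := x) (y := y) hr hq ?_ (fun t => ?_) fun t => ?_
    · by_contra! h
      exact hc (Complex.ext h.1 h.2)
    · have := congrArg (Polynomial.eval t) hT0
      simp only [Polynomial.eval_sub, Polynomial.eval_add, Polynomial.eval_pow, hle, hfe, hT,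
        Polynomial.eval_zero] at this
      linarith
    · have := congrArg (Polynomial.eval t) hF
      simp only [Polynomial.eval_sub, Polynomial.eval_add, Polynomial.eval_pow, hle, hfe, hD,
        Polynomial.eval_zero, Polynomial.eval_mul, Polynomial.eval_C, Polynomial.eval_ofNat] at this
      linarith
  · intro t ht
    have h := hroot _ ht
    have hpos : 0 ≤ E.supportForm ⟨c, c * t⟩ := by unfold Ellipse.supportForm; positivity
    have hs := Real.sq_sqrt hpos
    rw [Ellipse.support] at h
    generalize √(E.supportForm ⟨c, c * t⟩) = g at h hs
    rw [hform] at hs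
    simp only [Polynomial.eval_sub, Polynomial.eval_add, Polynomial.eval_pow, hle, hfe, hD, hT,
        Polynomial.eval_mul, Polynomial.eval_C, Polynomial.eval_ofNat]
    simp only [planeDot, ← hx, ← hy] at h hs
    have hTc : c ^ 2 * u ^ 2 + pencilTrace b₁ b₂ b c (c * t) / 2 =
        c ^ 2 * (u ^ 2 + pencilTrace b₁ b₂ b 1 t / 2) := by simp only [pencilTrace]; ring
    have hDc : pencilDisc b₁ b₂ b c (c * t) = c ^ 2 * pencilDisc b₁ b₂ b 1 t := by
      simp only [pencilDisc]; ring
    rw [hTc, hDc] at h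
    generalize u ^ 2 + pencilTrace b₁ b₂ b 1 t / 2 = T₀ at *
    generalize pencilDisc b₁ b₂ b 1 t = D₀ at *
    have hg : g ^ 2 = c ^ 2 * (p + 2 * q * t + r * t ^ 2) := by rw [hs]; ring
    generalize p + 2 * q * t + r * t ^ 2 = f₀ at *
    have hl' : c * x + c * t * y = c * (x + y * t) := by ring
    rw [hl'] at h
    generalize x + y * t = l₀ at *
    have e : c ^ 4 * ((l₀ ^ 2 + f₀ - T₀) ^ 2 + 4 * l₀ ^ 2 * f₀ - 4⁻¹ * D₀) =
        -(c ^ 3 * (4 * l₀ * (l₀ ^ 2 + f₀ - T₀)) * g) := by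
      have h' : ((c * l₀) ^ 2 + 2 * (c * l₀) * g + g ^ 2 - c ^ 2 * T₀) ^ 2 -
          c ^ 4 * D₀ / 4 = 0 := by linear_combination h
      rw [hg] at h'
      linear_combination h' - 4 * c ^ 2 * l₀ ^ 2 * hg
    have e2 := congrArg (· ^ 2) e
    have : c ^ 8 ≠ 0 := pow_ne_zero 8 hc0
    refine mul_left_cancel₀ this ?_
    linear_combination e2 + c ^ 6 * (4 * l₀ * (l₀ ^ 2 + f₀ - T₀)) ^ 2 * hg

/-! ### Sufficiency of the conditions. -/

theorem isBiElliptical_numericalRange {u b : ℝ} {b₁ b₂ : ℂ} (hb : b ≠ 0)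
    (h : (b₁.im = b₂.im ∧ 4 * b ^ 2 * u ^ 2 = (b₁.re ^ 2 - b₂.re ^ 2) ^ 2) ∨
      (u = 0 ∧ b₁.re = 0 ∧ b₂.re = 0)) :
    IsBiElliptical (numericalRange (triangularizedMatrix (u : ℂ) b₁ b₂ b)) := by
  -- Forced by the `s²` coefficient in `hD`, where the left side contributes `4 ((b₁.im - b₂.im)² +
  -- b²)`.
  set k := √((b₁.im - b₂.im) ^ 2 + b ^ 2) / 2 with hk
  have hk0 : 0 < k := by positivity
  have hk2 : 4 * k ^ 2 = (b₁.im - b₂.im) ^ 2 + b ^ 2 := by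
    rw [hk, div_pow, Real.sq_sqrt (by positivity)]; ring
  clear_value k
  set p := u ^ 2 + pencilTrace b₁ b₂ b 1 0 / 2 - k ^ 2 with hp
  set q := (b₁.im + b₂.im) / 2 with hq
  have hQ : ∀ c s : ℝ, c ^ 2 * u ^ 2 + pencilTrace b₁ b₂ b c s / 2 =
      (k * c) ^ 2 + (p * c ^ 2 + 2 * q * c * s + 1 * s ^ 2) := by
    intro c s
    simp only [hp, hq, pencilTrace]; ring
  have hD : ∀ c s : ℝ, pencilDisc b₁ b₂ b c s =
      16 * k ^ 2 * (p * c ^ 2 + 2 * q * c * s + 1 * s ^ 2) := by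
    intro c s
    have e : 16 * k ^ 2 * (p * c ^ 2 + 2 * q * c * s + 1 * s ^ 2) =
      4 * (4 * k ^ 2) * ((u ^ 2 + pencilTrace b₁ b₂ b 1 0 / 2 - 4 * k ^ 2 / 4) * c ^ 2 +
        (b₁.im + b₂.im) * c * s + s ^ 2) := by rw [hp, hq]; ring
    rw [e, hk2]
    simp only [pencilDisc, pencilTrace]
    rcases h with ⟨h1, h2⟩ | ⟨h1, h2, h3⟩
    · rw [h1]; linear_combination -c ^ 2 * h2
    · rw [h1, h2, h3]; ring
  -- `p - q²` is the minimum over `s` of the form at `c = 1`, taken at `s = -q`; there `pencilDisc`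
  -- is at least `b⁴`.
  have hpq : q ^ 2 < p * 1 := by
    have h1 : 16 * k ^ 2 * (p - q ^ 2) = pencilDisc b₁ b₂ b 1 (-q) := by rw [hD]; ring
    have h2 : 0 < pencilDisc b₁ b₂ b 1 (-q) := by unfold pencilDisc; positivity
    have h3 : 0 < p - q ^ 2 := by
      rw [← h1] at h2
      exact pos_of_mul_pos_right h2 (by positivity)
    linarith
  obtain ⟨E, hEc, hE⟩ := Ellipse.exists_of_supportForm (k : ℂ) one_pos hpq
  obtain ⟨F, hFc, hF⟩ := Ellipse.exists_of_supportForm (-k : ℂ) one_pos hpq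
  have hEs : ∀ w, E.support w = k * w.re + √(E.supportForm w) := fun w => by
    rw [Ellipse.support, planeDot, hEc]; simp [mul_comm]
  have hFs : ∀ w, F.support w = -(k * w.re) + √(E.supportForm w) := fun w => by
    rw [Ellipse.support, planeDot, hFc, hF, hE]; simp [mul_comm]
  have hdet : ∀ (w : ℂ) (r : ℝ), ((r : ℂ) • 1 -
      directionalPart (triangularizedMatrix (u : ℂ) b₁ b₂ b) w).det = 0 ↔
        (r ^ 2 - (k * w.re) ^ 2 - √(E.supportForm w) ^ 2) ^ 2 =
          (2 * (k * w.re) * √(E.supportForm w)) ^ 2 := by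
    intro w r
    have hpos : 0 ≤ E.supportForm w := by unfold Ellipse.supportForm; positivity
    rw [det_sub_directionalPart, Complex.ofReal_eq_zero, hQ, hD, ← hE, mul_pow _ (√_),
      Real.sq_sqrt hpos, ← sub_eq_zero (b := _ * _)]
    refine Eq.congr_left ?_
    ring
  refine ⟨E, F, ?_, ?_, ?_, ?_⟩
  · rw [hEc, hFc]
    exact_mod_cast (by linarith : (-k) < k).ne'
  · refine (E.not_curve_subset_disk_iff F).2 ⟨1, ?_⟩
    rw [hEs, hFs, Complex.one_re]; linarith
  · refine (F.not_curve_subset_disk_iff E).2 ⟨-1, ?_⟩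
    rw [hEs, hFs, Complex.neg_re, Complex.one_re]; linarith
  have hsupp : ∀ w, max (E.support w) (F.support w) = |k * w.re| + √(E.supportForm w) := by
    intro w
    rw [hEs, hFs, max_add_add_right, ← abs_eq_max_neg]
  refine subset_antisymm (subset_of_support_le (h := fun w => max (E.support w) (F.support w))
    (convex_convexHull ℝ _) ?_ ?_ ?_) (convexHull_min ?_ (convex_numericalRange _))
  · exact (isCompact_convexHull_of_finiteDimensional
      (E.isCompact_curve.union F.isCompact_curve)).isClosed
  · intro w z hz
    obtain ⟨z', hz', hmax⟩ := (isCompact_numericalRange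
      (triangularizedMatrix (u : ℂ) b₁ b₂ b)).exists_isMaxOn (numericalRange_nonempty _)
      (f := planeDot w) (by unfold planeDot; fun_prop)
    refine (hmax hz).trans ?_
    have hr := (hdet w _).1 (det_directionalPart_eq_zero (fun y hy => hmax hy) ⟨z', hz', rfl⟩)
    rw [hsupp]
    -- A root `r > a + g` would give `r² - a² - g² > 2ag`, against `hr`.
    by_contra! hlt
    have hg := Real.sqrt_nonneg (E.supportForm w)
    have ha := abs_nonneg (k * w.re)
    rw [← sq_abs (k * w.re), mul_pow, mul_pow, ← sq_abs (k * w.re)] at hr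
    generalize √(E.supportForm w) = g at *
    generalize |k * w.re| = a at *
    have h1 : (a + g) ^ 2 < planeDot w z' ^ 2 := by gcongr
    have h2 : (2 * a * g) ^ 2 < (planeDot w z' ^ 2 - a ^ 2 - g ^ 2) ^ 2 := by
      gcongr; linarith
    linarith
  · intro w
    rcases max_choice (E.support w) (F.support w) with hm | hm <;> rw [hm]
    · obtain ⟨z, hz, hzw⟩ := E.exists_planeDot_eq_support w
      exact ⟨z, subset_convexHull ℝ _ (Or.inl hz), hzw⟩
    · obtain ⟨z, hz, hzw⟩ := F.exists_planeDot_eq_support w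
      exact ⟨z, subset_convexHull ℝ _ (Or.inr hz), hzw⟩
  · refine subset_of_support_le (h := fun w => max (E.support w) (F.support w))
      (convex_numericalRange _) (isCompact_numericalRange _).isClosed ?_ fun w => ?_
    · rintro w z (hz | hz)
      · exact (E.planeDot_le_support w hz).trans (le_max_left _ _)
      · exact (F.planeDot_le_support w hz).trans (le_max_right _ _)
    -- No maximality is needed here: an eigenvector for `|kc| + √f` gives a point of `W(A)` at that
    -- height.
    · refine exists_planeDot_eq_of_det ((hdet w _).2 ?_)
      rw [hsupp]
      have h1 := sq_abs (k * w.re)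
      generalize √(E.supportForm w) = g at *
      generalize |k * w.re| = a at *
      rw [show (2 * (k * w.re) * g) ^ 2 = 4 * (k * w.re) ^ 2 * g ^ 2 by ring, ← h1]; ring

theorem theorem4p1 (u : ℝ) (b₁ b₂ : ℂ) (b : ℝ) (hb : 0 ≤ b) :
    IsBiElliptical (numericalRange (triangularizedMatrix (u : ℂ) b₁ b₂ b)) ↔
      b ≠ 0 ∧
        ((b₁.im = b₂.im ∧ 4 * b ^ 2 * u ^ 2 = (b₁.re ^ 2 - b₂.re ^ 2) ^ 2) ∨
          (u = 0 ∧ b₁.re = 0 ∧ b₂.re = 0)) := by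
  refine ⟨?_, fun h => isBiElliptical_numericalRange h.1 h.2⟩
  rintro ⟨E, F, hne, hEF, hFE, hW⟩
  by_cases hE : E.center = 0
  · exact parameter_conditions_of_convexHull (fun hF => hne (hE.trans hF.symm)) hFE
      (by rw [hW, Set.union_comm])
  · exact parameter_conditions_of_convexHull hE hEF hW
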